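/- All rings are commutative with $1$. Let $R$ be a ring. An injective homomorphism $f\colon A\to B$ of $R$-modules is called a pure injection if $f\otimes 1_X\colon A\otimes_R X\to B\otimes_R X$ is injective for every $R$-module $X$. A short exact sequence $0\to A\xrightarrow{f} B\to C\to 0$ of $R$-modules is called pure if $f$ is a pure injection. An $R$-module $M$ is pure-projective if $\operatorname{Hom}_R(M,B)\to\operatorname{Hom}_R(M,C)$ is surjective for every pure short exact sequence $0\to A\to B\to C\to 0$ of $R$-modules. A ring extension $R\subseteq S$ is pure if the inclusion $R\hookrightarrow S$ is a pure injection of $R$-modules. (1) Let $R\subseteq S$ be a pure extension of commutative rings, and let $M$ be an $R$-module. Then $M$ is a pure-projective $R$-module if and only if $M\otimes_R S$ is a pure-projective $S$-module. (2) Let $R$ be a commutative noetherian local ring with maximal ideal $\mathfrak m$, let $\widehat R$ be its $\mathfrak m$-adic completion, and let $P$ be an $R$-module. Then $P$ is a pure-projective $R$-module if and only if $P\otimes_R\widehat R$ is a pure-projective $\widehat R$-module. -/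

import Mathlib

open scoped TensorProduct

universe u v w

/-- An injective linear map `f : A → B` is a *pure injection* if `f ⊗ 1_X : A ⊗ X → B ⊗ X` is
injective for every `R`-module `X`. It suffices to test finitely presented modules `X`, and these
all have a copy in the universe of `R`, so letting `X` range over that universe loses nothing. -/
structure IsPureInjection {R : Type u} [CommRing R] {A : Type v} {B : Type w}
    [AddCommGroup A] [Module R A] [AddCommGroup B] [Module R B] (f : A →ₗ[R] B) : Prop where
  injective : Function.Injective f
  rTensor_injective : ∀ (X : Type u) [AddCommGroup X] [Module R X],
    Function.Injective (f.rTensor X)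

/-- `0 → A → B → C → 0` is a pure (short) exact sequence. -/
structure IsPureExact {R : Type u} [CommRing R] {A B C : Type v}
    [AddCommGroup A] [Module R A] [AddCommGroup B] [Module R B] [AddCommGroup C] [Module R C]
    (f : A →ₗ[R] B) (g : B →ₗ[R] C) : Prop where
  pure : IsPureInjection f
  exact : Function.Exact f g
  surjective : Function.Surjective g

/-- `M` is *pure-projective* if `Hom(M, B) → Hom(M, C)` is surjective for every pure exact
sequence `0 → A → B → C → 0`. The universe `max u v` contains copies of `M` and of all direct sums,
indexed by small sets, of finitely presented modules, in particular of a pure presentation of `M`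
by such a sum; so larger universes would give the same notion. -/
def IsPureProjective (R : Type u) [CommRing R] (M : Type v) [AddCommGroup M] [Module R M] : Prop :=
  ∀ (A B C : Type (max u v)) [AddCommGroup A] [Module R A] [AddCommGroup B] [Module R B]
    [AddCommGroup C] [Module R C] (f : A →ₗ[R] B) (g : B →ₗ[R] C), IsPureExact f g →
    ∀ h : M →ₗ[R] C, ∃ k : M →ₗ[R] B, g ∘ₗ k = h

/-- An `R`-algebra `S` is a *pure extension* of `R` if the structure map `R → S` is a pure
injection of `R`-modules. -/
def IsPureExtension (R : Type u) (S : Type v) [CommRing R] [CommRing S] [Algebra R S] : Prop :=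
  IsPureInjection (Algebra.linearMap R S)

/-!
Pure-projectivity ascends because purity of a short exact sequence is tested by lifting maps from
finitely presented modules, so it survives restriction of scalars. The completion of a noetherian
local ring is faithfully flat, hence pure.

For descent along a pure extension `R → S`, write `S ⊗ M` as a retract of a direct sum
of finitely presented `S`-modules. Approximating `M` by finitely presented modules, one can put any
element of `M` in the union of a countable tower whose partial images in `S ⊗ M` alternate with
finite partial sums of this direct sum. Each finite partial sum factors the base change of a
transition map through the map to `S ⊗ M`, and by purity of the extension the transition map itself
dominates the map to `M` in the sense of Raynaud and Gruson. The tower is thus a countable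
Mittag-Leffler system, so that its union is a pure submodule of `M`, and pure-projective because
lifts can be corrected one stage at a time. The union is moreover compatible with the decomposition
of `S ⊗ M`, so that the base change of the quotient is again a retract of a direct sum, and the
construction can be repeated there. Zorn's lemma, applied to partial lifts of a map along a pure
epimorphism, takes the place of a transfinite filtration of `M`.
-/

section Domination

variable {R : Type u} [CommRing R]

theorem finitePresentation_quotient_of_fg {E : Type*} [AddCommGroup E] [Module R E]
    [Module.FinitePresentation R E] {K : Submodule R E} (hK : K.FG) :
    Module.FinitePresentation R (E ⧸ K) :=
  Module.finitePresentation_of_surjective K.mkQ K.mkQ_surjective (by simpa using hK)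

variable {A B C N N₁ N₂ N₃ : Type*} [AddCommGroup A] [Module R A] [AddCommGroup B] [Module R B]
  [AddCommGroup C] [Module R C] [AddCommGroup N] [Module R N] [AddCommGroup N₁] [Module R N₁]
  [AddCommGroup N₂] [Module R N₂] [AddCommGroup N₃] [Module R N₃]

/-- A map `ψ` *dominates* a map `φ` with the same source if `ψ ⊗ W` kills the kernel of `φ ⊗ W`,
for all modules `W` (Raynaud–Gruson). As for purity, finitely presented `W` are enough, so `W`
ranges over the universe of `R`. -/
def Dominates (ψ : N →ₗ[R] N₂) (φ : N →ₗ[R] N₁) : Prop :=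
  ∀ (W : Type u) [AddCommGroup W] [Module R W],
    LinearMap.ker (φ.rTensor W) ≤ LinearMap.ker (ψ.rTensor W)

theorem dominates_comp (φ : N →ₗ[R] N₁) (δ : N₁ →ₗ[R] N₂) : Dominates (δ ∘ₗ φ) φ :=
  fun W _ _ => by
    rw [LinearMap.rTensor_comp]
    exact LinearMap.ker_le_ker_comp _ _

namespace Dominates

variable {φ : N →ₗ[R] N₁} {ψ : N →ₗ[R] N₂} {χ : N →ₗ[R] N₃}

theorem trans (hχψ : Dominates χ ψ) (hψφ : Dominates ψ φ) : Dominates χ φ :=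
  fun W _ _ => (hψφ W).trans (hχψ W)

theorem ker_le (h : Dominates ψ φ) : LinearMap.ker φ ≤ LinearMap.ker ψ := by
  intro x hx
  have : x ⊗ₜ[R] (1 : R) ∈ LinearMap.ker (ψ.rTensor R) := h R (by simp [LinearMap.mem_ker.1 hx])
  simpa using congr_arg (TensorProduct.rid R N₂) (LinearMap.mem_ker.1 this)

end Dominates

theorem isPureInjection_iff_dominates {f : A →ₗ[R] B} :
    IsPureInjection f ↔ Dominates LinearMap.id f := by
  refine ⟨fun hf W _ _ => ?_, fun hf => ⟨?_, fun W _ _ => ?_⟩⟩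
  · simp [LinearMap.ker_eq_bot.2 (hf.rTensor_injective W)]
  · simpa [LinearMap.ker_eq_bot] using hf.ker_le
  · simpa [LinearMap.ker_eq_bot] using hf W

theorem IsPureInjection.dominates_of_comp {i : N₂ →ₗ[R] N₃} (hi : IsPureInjection i)
    {ψ : N →ₗ[R] N₂} {φ : N →ₗ[R] N₁} (h : Dominates (i ∘ₗ ψ) φ) : Dominates ψ φ := by
  intro W _ _
  rw [← LinearMap.ker_comp_of_ker_eq_bot _ (LinearMap.ker_eq_bot.2 (hi.rTensor_injective W)),
    ← LinearMap.rTensor_comp]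
  exact h W

section Obstruction

variable {F G : Type*} [AddCommGroup F] [Module R F] [AddCommGroup G] [Module R G]
  [Module.Finite R G] [Module.Projective R G]

/-- The obstruction to extending `a : G → N` along a map `D : G → F` of finitely generated
projective modules: the class of `a` under `Hom(G, N) ≃ G* ⊗ N → coker (D* : F* → G*) ⊗ N`. -/
noncomputable def extensionObstruction (D : G →ₗ[R] F) (a : G →ₗ[R] N) :
    N ⊗[R] (Module.Dual R G ⧸ LinearMap.range D.dualMap) :=
  TensorProduct.comm R _ N
    ((LinearMap.range D.dualMap).mkQ.rTensor N ((dualTensorHomEquiv R G N).symm a))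

theorem rTensor_extensionObstruction (D : G →ₗ[R] F) (a : G →ₗ[R] N) (φ : N →ₗ[R] N₁) :
    φ.rTensor _ (extensionObstruction D a) = extensionObstruction D (φ ∘ₗ a) := by
  obtain ⟨t, rfl⟩ := (dualTensorHomEquiv R G N).surjective a
  have hφ : φ ∘ₗ dualTensorHomEquiv R G N t = dualTensorHomEquiv R G N₁ (φ.lTensor _ t) :=
    (LinearMap.congr_fun (dualTensorHom_comp_lTensor φ) t).symm
  simp only [extensionObstruction, hφ, LinearEquiv.symm_apply_apply, LinearMap.rTensor_comm]
  simp only [← LinearMap.comp_apply, LinearMap.lTensor_comp_rTensor, LinearMap.rTensor_comp_lTensor]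

theorem extensionObstruction_eq_zero_iff [Module.Finite R F] [Module.Projective R F]
    {D : G →ₗ[R] F} {a : G →ₗ[R] N} :
    extensionObstruction D a = 0 ↔ ∃ b : F →ₗ[R] N, b ∘ₗ D = a := by
  have h_comp (t : Module.Dual R F ⊗[R] N) : dualTensorHomEquiv R G N (D.dualMap.rTensor N t) =
      dualTensorHomEquiv R F N t ∘ₗ D :=
    LinearMap.congr_fun (dualTensorHom_comp_rTensor_dualMap D) t
  rw [extensionObstruction, LinearEquiv.map_eq_zero_iff,
    rTensor_exact N (LinearMap.exact_map_mkQ_range _) (Submodule.mkQ_surjective _),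
    (dualTensorHomEquiv R F N).surjective.exists]
  simp only [← h_comp, Set.mem_range, LinearEquiv.eq_symm_apply]

end Obstruction

section Extension

variable {X Y : Type*} [AddCommGroup X] [Module R X] [AddCommGroup Y] [Module R Y]
  {φ : N →ₗ[R] N₁} {ψ : N →ₗ[R] N₂}

theorem Dominates.exists_extension_of_projective (h : Dominates ψ φ) {F G : Type u}
    [AddCommGroup F] [Module R F] [Module.Finite R F] [Module.Projective R F]
    [AddCommGroup G] [Module R G] [Module.Finite R G] [Module.Projective R G]
    (D : G →ₗ[R] F) (a : G →ₗ[R] N) {b : F →ₗ[R] N₁} (hb : b ∘ₗ D = φ ∘ₗ a) :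
    ∃ c : F →ₗ[R] N₂, c ∘ₗ D = ψ ∘ₗ a := by
  rw [← extensionObstruction_eq_zero_iff, ← rTensor_extensionObstruction]
  apply h
  rw [LinearMap.mem_ker, rTensor_extensionObstruction]
  exact extensionObstruction_eq_zero_iff.2 ⟨b, hb⟩

theorem Dominates.exists_extension [Module.Finite R X] [Module.FinitePresentation R Y]
    (h : Dominates ψ φ) (D : X →ₗ[R] Y) (a : X →ₗ[R] N) {b : Y →ₗ[R] N₁} (hb : b ∘ₗ D = φ ∘ₗ a) :
    ∃ c : Y →ₗ[R] N₂, c ∘ₗ D = ψ ∘ₗ a := by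
  obtain ⟨k, σ, hσ⟩ := Module.Finite.exists_fin' R X
  obtain ⟨n, m, π, rel, hπ, hrel⟩ := Module.FinitePresentation.exists_fin' R Y
  obtain ⟨D', hD'⟩ := Module.projective_lifting_property π (D ∘ₗ σ) hπ
  obtain ⟨c', hc'⟩ := h.exists_extension_of_projective (D'.coprod rel) ((a ∘ₗ σ).coprod 0)
    (b := b ∘ₗ π) (by
      rw [LinearMap.comp_coprod, LinearMap.comp_coprod, LinearMap.comp_assoc, hD',
        LinearMap.comp_assoc, hrel.linearMap_comp_eq_zero, ← LinearMap.comp_assoc, hb]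
      simp only [LinearMap.comp_assoc, LinearMap.comp_zero])
  have hcD : c' ∘ₗ D' = ψ ∘ₗ a ∘ₗ σ := by
    simpa [LinearMap.comp_assoc] using congr($hc' ∘ₗ .inl R _ _)
  have hcrel : c' ∘ₗ rel = 0 := by
    simpa [LinearMap.comp_assoc] using congr($hc' ∘ₗ .inr R _ _)
  obtain ⟨c, rfl⟩ := (LinearMap.exact_lcomp_of_exact_of_surjective N₂ hrel hπ c').1 hcrel
  refine ⟨c, ?_⟩
  rw [← LinearMap.cancel_right hσ, LinearMap.comp_assoc, LinearMap.comp_assoc, ← hD', ← hcD]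
  rfl

theorem Dominates.exists_comp_eq [Module.Finite R N] [Module.FinitePresentation R N₁]
    (h : Dominates ψ φ) : ∃ r : N₁ →ₗ[R] N₂, r ∘ₗ φ = ψ :=
  h.exists_extension φ LinearMap.id (b := LinearMap.id) rfl

theorem IsPureInjection.exists_lift_of_finitePresentation {f : A →ₗ[R] B} {g : B →ₗ[R] C}
    (hf : IsPureInjection f) (hfg : Function.Exact f g) (hg : Function.Surjective g)
    [Module.FinitePresentation R Y] (h : Y →ₗ[R] C) : ∃ k : Y →ₗ[R] B, g ∘ₗ k = h := by
  obtain ⟨n, m, π, rel, hπ, hrel⟩ := Module.FinitePresentation.exists_fin' R Y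
  obtain ⟨b, hb⟩ := Module.projective_lifting_property g (h ∘ₗ π) hg
  have hbrel : g ∘ₗ b ∘ₗ rel = 0 := by
    rw [← LinearMap.comp_assoc, hb, LinearMap.comp_assoc, hrel.linearMap_comp_eq_zero,
      LinearMap.comp_zero]
  obtain ⟨a, ha⟩ := Module.projective_lifting_property f.rangeRestrict
    ((b ∘ₗ rel).codRestrict (LinearMap.range f) fun x => (hfg _).1 congr($hbrel x))
    f.surjective_rangeRestrict
  have hba : b ∘ₗ rel = f ∘ₗ a := LinearMap.ext fun x => congr(($ha x).1).symm
  obtain ⟨c, hc⟩ := (isPureInjection_iff_dominates.1 hf).exists_extension rel a hba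
  obtain ⟨k, hk⟩ := (LinearMap.exact_lcomp_of_exact_of_surjective B hrel hπ (b - f ∘ₗ c)).1 <| by
    change (b - f ∘ₗ c) ∘ₗ rel = 0
    rw [LinearMap.sub_comp, LinearMap.comp_assoc, hc, hba, LinearMap.id_comp, sub_self]
  refine ⟨k, ?_⟩
  rw [← LinearMap.cancel_right hπ, LinearMap.comp_assoc, show k ∘ₗ π = _ from hk,
    LinearMap.comp_sub, ← LinearMap.comp_assoc, hfg.linearMap_comp_eq_zero,
    LinearMap.zero_comp, sub_zero, hb]

end Extension

end Domination

theorem exists_fg_le_ker_rTensor_mkQ_eq_zero {R A B W : Type*} [CommRing R] [AddCommGroup A]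
    [Module R A] [AddCommGroup B] [Module R B] [AddCommGroup W] [Module R W] {q : A →ₗ[R] B}
    (hq : Function.Surjective q) {z : A ⊗[R] W} (hz : q.rTensor W z = 0) :
    ∃ K ≤ LinearMap.ker q, K.FG ∧ K.mkQ.rTensor W z = 0 := by
  obtain ⟨t, rfl⟩ := (rTensor_exact W q.exact_subtype_ker_map hq z).1 hz
  obtain ⟨K, hK, t, rfl⟩ := TensorProduct.exists_of_fg t
  refine ⟨K.map (LinearMap.ker q).subtype, Submodule.map_subtype_le _ _, hK.map _, ?_⟩
  have h0 : (K.map (LinearMap.ker q).subtype).mkQ ∘ₗ (LinearMap.ker q).subtype ∘ₗ K.subtype = 0 :=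
    LinearMap.ext fun x => (Submodule.Quotient.mk_eq_zero _).2 ⟨x.1, x.2, rfl⟩
  simp only [← LinearMap.comp_apply, ← LinearMap.rTensor_comp, h0,
    LinearMap.rTensor_zero, LinearMap.zero_apply]

section Range

variable {R A B N W : Type*} [CommRing R] [AddCommGroup A] [Module R A] [AddCommGroup B]
  [Module R B] [AddCommGroup N] [Module R N] [AddCommGroup W] [Module R W]
  {k : A →ₗ[R] N} {l : B →ₗ[R] N}

theorem range_lTensor_mono (h : LinearMap.range k ≤ LinearMap.range l) :
    LinearMap.range (k.lTensor W) ≤ LinearMap.range (l.lTensor W) := by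
  rw [LinearMap.lTensor_range W (g := k), LinearMap.lTensor_range W (g := l),
    ← Submodule.subtype_comp_inclusion _ _ h, LinearMap.lTensor_comp]
  exact LinearMap.range_comp_le_range _ _

theorem range_rTensor_mono (h : LinearMap.range k ≤ LinearMap.range l) :
    LinearMap.range (k.rTensor W) ≤ LinearMap.range (l.rTensor W) := by
  rw [LinearMap.rTensor_range W (g := k), LinearMap.rTensor_range W (g := l),
    ← Submodule.subtype_comp_inclusion _ _ h, LinearMap.rTensor_comp]
  exact LinearMap.range_comp_le_range _ _

end Range

/-- A finitely presented module over `M`. Every module is the filtered colimit of these, the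
transition maps from `X` to `Y` being the maps `g` with `Y.hom ∘ₗ g = X.hom`. The carrier lives in
the universe of `R`, which loses nothing up to isomorphism. -/
structure FPModuleOver (R : Type u) [CommRing R] (M : Type w) [AddCommGroup M] [Module R M] where
  carrier : Type u
  [addCommGroup : AddCommGroup carrier]
  [module : Module R carrier]
  [finitePresentation : Module.FinitePresentation R carrier]
  hom : carrier →ₗ[R] M

namespace FPModuleOver

variable {R : Type u} [CommRing R] {M : Type w} [AddCommGroup M] [Module R M]

instance : CoeSort (FPModuleOver R M) (Type u) := ⟨carrier⟩

attribute [instance] addCommGroup module finitePresentation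

theorem exists_range_eq_sup (X : FPModuleOver R M) {N : Submodule R M} (hN : N.FG) :
    ∃ Y : FPModuleOver R M, ∃ g : X →ₗ[R] Y,
      Y.hom ∘ₗ g = X.hom ∧ LinearMap.range Y.hom = LinearMap.range X.hom ⊔ N := by
  have : Module.Finite R N := Module.Finite.iff_fg.2 hN
  obtain ⟨n, π, hπ⟩ := Module.Finite.exists_fin' R N
  refine ⟨⟨X × (Fin n → R), X.hom.coprod (N.subtype ∘ₗ π)⟩, LinearMap.inl _ _ _,
    LinearMap.coprod_inl _ _, ?_⟩
  rw [LinearMap.range_coprod, LinearMap.range_comp, LinearMap.range_eq_top.2 hπ,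
    Submodule.map_subtype_top]

/-- First enlarge the image of `X` so that `z` dies in its tensor product, then kill finitely many
relations. -/
theorem exists_rTensor_eq_zero (X : FPModuleOver R M) {W : Type*} [AddCommGroup W] [Module R W]
    {z : X ⊗[R] W} (hz : X.hom.rTensor W z = 0) :
    ∃ Y : FPModuleOver R M, ∃ g : X →ₗ[R] Y, Y.hom ∘ₗ g = X.hom ∧ g.rTensor W z = 0 := by
  have hz' : (LinearMap.range X.hom).subtype.rTensor W (X.hom.rangeRestrict.rTensor W z) = 0 := by
    rw [← LinearMap.comp_apply, ← LinearMap.rTensor_comp, LinearMap.subtype_comp_codRestrict, hz]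
  obtain ⟨N, hXN, hN, hzN⟩ :=
    TensorProduct.eq_zero_of_fg_of_subtype_eq_zero (by simp) hz'
  obtain ⟨Y, g, hg, hY⟩ := X.exists_range_eq_sup hN
  obtain rfl : LinearMap.range Y.hom = N := hY.trans (sup_eq_right.2 hXN)
  have hYg : Y.hom.rangeRestrict ∘ₗ g = Submodule.inclusion hXN ∘ₗ X.hom.rangeRestrict :=
    LinearMap.ext fun x => Subtype.ext (LinearMap.congr_fun hg x)
  obtain ⟨K, hKq, hK, hKz⟩ := exists_fg_le_ker_rTensor_mkQ_eq_zero (z := g.rTensor W z)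
    Y.hom.surjective_rangeRestrict (by
      rw [← LinearMap.comp_apply, ← LinearMap.rTensor_comp, hYg, LinearMap.rTensor_comp,
        LinearMap.comp_apply, hzN])
  have := finitePresentation_quotient_of_fg hK
  rw [LinearMap.ker_rangeRestrict] at hKq
  refine ⟨⟨Y ⧸ K, K.liftQ Y.hom hKq⟩, K.mkQ ∘ₗ g, ?_, ?_⟩
  · rw [← LinearMap.comp_assoc, Submodule.liftQ_mkQ, hg]
  · rw [LinearMap.rTensor_comp, LinearMap.comp_apply, hKz]

theorem exists_rTensor_eq {W : Type*} [AddCommGroup W] [Module R W] (z : M ⊗[R] W) :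
    ∃ X : FPModuleOver R M, ∃ t : X ⊗[R] W, X.hom.rTensor W t = z := by
  obtain ⟨N, hN, t, rfl⟩ := TensorProduct.exists_of_fg z
  have : Module.Finite R N := Module.Finite.iff_fg.2 hN
  obtain ⟨n, π, hπ⟩ := Module.Finite.exists_fin' R N
  obtain ⟨t, rfl⟩ := LinearMap.rTensor_surjective W hπ t
  exact ⟨⟨Fin n → R, N.subtype ∘ₗ π⟩, t, by rw [LinearMap.rTensor_comp]; rfl⟩

section BaseChange

variable {S : Type v} [CommRing S] [Algebra R S]

theorem exists_subset_range_baseChange (X : FPModuleOver R M) {Z : Set (S ⊗[R] M)}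
    (hZ : Z.Finite) :
    ∃ Y : FPModuleOver R M, ∃ g : X →ₗ[R] Y,
      Y.hom ∘ₗ g = X.hom ∧ Z ⊆ LinearMap.range (Y.hom.baseChange S) := by
  obtain ⟨N, hN, hNZ⟩ := TensorProduct.exists_finite_submodule_right_of_setFinite Z hZ
  obtain ⟨Y, g, hg, hY⟩ := X.exists_range_eq_sup (Module.Finite.iff_fg.1 hN)
  exact ⟨Y, g, hg, hNZ.trans (range_lTensor_mono (by simp [hY]))⟩

theorem exists_baseChange_eq_zero (X : FPModuleOver R M) {z : S ⊗[R] X}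
    (hz : X.hom.baseChange S z = 0) :
    ∃ Y : FPModuleOver R M, ∃ g : X →ₗ[R] Y, Y.hom ∘ₗ g = X.hom ∧ g.baseChange S z = 0 := by
  obtain ⟨Y, g, hg, hz⟩ := X.exists_rTensor_eq_zero (z := TensorProduct.comm R S X z) (by
    rw [LinearMap.rTensor_comm]
    exact (LinearEquiv.map_eq_zero_iff _).2 hz)
  exact ⟨Y, g, hg, (LinearEquiv.map_eq_zero_iff _).1 ((LinearMap.rTensor_comm g z).symm.trans hz)⟩

theorem exists_baseChange_comp_eq_comp (X : FPModuleOver R M) {P : Type*} [AddCommMonoid P]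
    [Module S P] [Module.Finite S P] {a b : P →ₗ[S] S ⊗[R] X}
    (hab : X.hom.baseChange S ∘ₗ a = X.hom.baseChange S ∘ₗ b) :
    ∃ Y : FPModuleOver R M, ∃ g : X →ₗ[R] Y,
      Y.hom ∘ₗ g = X.hom ∧ g.baseChange S ∘ₗ a = g.baseChange S ∘ₗ b := by
  classical
  obtain ⟨G, hG⟩ := Module.Finite.fg_top (R := S) (M := P)
  suffices h : ∀ T : Finset P, ∃ Y : FPModuleOver R M, ∃ g : X →ₗ[R] Y,
      Y.hom ∘ₗ g = X.hom ∧ ∀ x ∈ T, g.baseChange S (a x) = g.baseChange S (b x) by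
    obtain ⟨Y, g, hg, h_eq⟩ := h G
    exact ⟨Y, g, hg, LinearMap.ext_on hG h_eq⟩
  intro T
  induction T using Finset.induction_on with
  | empty => exact ⟨X, LinearMap.id, rfl, by simp⟩
  | insert x T _ ih =>
    obtain ⟨Y, g, hg, h_eq⟩ := ih
    obtain ⟨Y', g', hg', hx⟩ := Y.exists_baseChange_eq_zero (z := g.baseChange S (a x - b x)) (by
      rw [← LinearMap.comp_apply, ← LinearMap.baseChange_comp, hg, map_sub, sub_eq_zero]
      exact LinearMap.congr_fun hab x)
    refine ⟨Y', g' ∘ₗ g, by rw [← LinearMap.comp_assoc, hg', hg], ?_⟩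
    simp only [Finset.forall_mem_insert, LinearMap.baseChange_comp, LinearMap.comp_apply]
    refine ⟨?_, fun y hy => by rw [h_eq y hy]⟩
    rwa [map_sub, map_sub, sub_eq_zero] at hx

variable {Q : Type*} [AddCommGroup Q] [Module S Q]

theorem exists_lift_baseChange [Module.FinitePresentation S Q] (X : FPModuleOver R M)
    (b : Q →ₗ[S] S ⊗[R] M) :
    ∃ Y : FPModuleOver R M, ∃ (g : X →ₗ[R] Y) (c : Q →ₗ[S] S ⊗[R] Y),
      Y.hom ∘ₗ g = X.hom ∧ Y.hom.baseChange S ∘ₗ c = b := by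
  obtain ⟨n, m, π, rel, hπ, hrel⟩ := Module.FinitePresentation.exists_fin' S Q
  obtain ⟨Y, g, hg, hY⟩ := X.exists_subset_range_baseChange
    (Set.finite_range fun j : Fin n => b (π (Pi.single j 1)))
  choose y hy using fun j => hY (Set.mem_range_self j)
  let c₀ : (Fin n → S) →ₗ[S] S ⊗[R] Y := Fintype.linearCombination S y
  have hc₀ : Y.hom.baseChange S ∘ₗ c₀ = b ∘ₗ π :=
    LinearMap.pi_ext' fun j => LinearMap.ext_ring (by simpa [c₀] using hy j)
  obtain ⟨Y', g', hg', hrel'⟩ := Y.exists_baseChange_comp_eq_comp (a := c₀ ∘ₗ rel) (b := 0) (by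
    rw [← LinearMap.comp_assoc, hc₀, LinearMap.comp_assoc, hrel.linearMap_comp_eq_zero]
    simp only [LinearMap.comp_zero])
  rw [LinearMap.comp_zero] at hrel'
  obtain ⟨c, hc⟩ := (LinearMap.exact_lcomp_of_exact_of_surjective _ hrel hπ
    (g'.baseChange S ∘ₗ c₀)).1 hrel'
  refine ⟨Y', g' ∘ₗ g, c, by rw [← LinearMap.comp_assoc, hg', hg], ?_⟩
  rw [← LinearMap.cancel_right hπ, LinearMap.comp_assoc, show c ∘ₗ π = _ from hc,
    ← LinearMap.comp_assoc, ← LinearMap.baseChange_comp, hg', hc₀]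

theorem exists_factor_baseChange [Module.FinitePresentation S Q] (X : FPModuleOver R M)
    {a : S ⊗[R] X →ₗ[S] Q} {b : Q →ₗ[S] S ⊗[R] M} (hab : b ∘ₗ a = X.hom.baseChange S) :
    ∃ Y : FPModuleOver R M, ∃ (g : X →ₗ[R] Y) (c : Q →ₗ[S] S ⊗[R] Y),
      Y.hom ∘ₗ g = X.hom ∧ c ∘ₗ a = g.baseChange S ∧ Y.hom.baseChange S ∘ₗ c = b := by
  obtain ⟨Y, g, c, hg, hc⟩ := X.exists_lift_baseChange b
  obtain ⟨Y', g', hg', h_eq⟩ := Y.exists_baseChange_comp_eq_comp (a := c ∘ₗ a)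
    (b := g.baseChange S) (by rw [← LinearMap.comp_assoc, hc, hab, ← LinearMap.baseChange_comp, hg])
  refine ⟨Y', g' ∘ₗ g, g'.baseChange S ∘ₗ c, by rw [← LinearMap.comp_assoc, hg', hg], ?_, ?_⟩
  · rw [LinearMap.comp_assoc, h_eq, LinearMap.baseChange_comp]
  · rw [← LinearMap.comp_assoc, ← LinearMap.baseChange_comp, hg', hc]

end BaseChange

end FPModuleOver

section PureProjective

variable {R : Type u} [CommRing R]

section Converse

variable {A B C : Type*} [AddCommGroup A] [Module R A] [AddCommGroup B] [Module R B]
  [AddCommGroup C] [Module R C]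

theorem isPureInjection_of_exists_lift {f : A →ₗ[R] B} {g : B →ₗ[R] C}
    (hf : Function.Injective f) (hfg : Function.Exact f g)
    (hlift : ∀ (E : Type u) [AddCommGroup E] [Module R E] [Module.FinitePresentation R E]
      (h : E →ₗ[R] C), ∃ k : E →ₗ[R] B, g ∘ₗ k = h) : IsPureInjection f := by
  refine ⟨hf, fun W _ _ => (injective_iff_map_eq_zero _).2 fun z hz => ?_⟩
  obtain ⟨X, t, rfl⟩ := FPModuleOver.exists_rTensor_eq z
  obtain ⟨Y, γ, hγ, ht⟩ := FPModuleOver.exists_rTensor_eq_zero (z := t) ⟨X, f ∘ₗ X.hom⟩ (by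
    rwa [← LinearMap.comp_apply, ← LinearMap.rTensor_comp] at hz)
  have := finitePresentation_quotient_of_fg (K := LinearMap.range γ) (by simp)
  have hγ_exact : Function.Exact γ (LinearMap.range γ).mkQ := LinearMap.exact_map_mkQ_range γ
  obtain ⟨h, hh⟩ := (LinearMap.exact_lcomp_of_exact_of_surjective C hγ_exact
    (Submodule.mkQ_surjective _) (g ∘ₗ Y.hom)).1 <| by
      change (g ∘ₗ Y.hom) ∘ₗ γ = 0
      rw [LinearMap.comp_assoc, hγ, ← LinearMap.comp_assoc, hfg.linearMap_comp_eq_zero,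
        LinearMap.zero_comp]
  obtain ⟨k, hk⟩ := hlift _ h
  have hgk : g ∘ₗ (Y.hom - k ∘ₗ (LinearMap.range γ).mkQ) = 0 := by
    rw [LinearMap.comp_sub, ← LinearMap.comp_assoc, hk, show h ∘ₗ _ = _ from hh, sub_self]
  let α : Y →ₗ[R] A := LinearMap.codRestrictOfInjective
    (Y.hom - k ∘ₗ (LinearMap.range γ).mkQ) f hf fun y => (hfg _).1 (LinearMap.congr_fun hgk y)
  have hα : f ∘ₗ α = Y.hom - k ∘ₗ (LinearMap.range γ).mkQ :=
    LinearMap.codRestrictOfInjective_comp _ _ _ _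
  have hαγ : α ∘ₗ γ = X.hom := by
    rw [← LinearMap.cancel_left hf, ← LinearMap.comp_assoc, hα, LinearMap.sub_comp, hγ,
      LinearMap.comp_assoc, hγ_exact.linearMap_comp_eq_zero, LinearMap.comp_zero, sub_zero]
  rw [← hαγ, LinearMap.rTensor_comp, LinearMap.comp_apply, ht, map_zero]

theorem IsPureInjection.restrictScalars {S : Type v} [CommRing S] [Algebra R S] [Module S A]
    [Module S B] [IsScalarTower R S A] [IsScalarTower R S B] {f : A →ₗ[S] B}
    (hf : IsPureInjection f) : IsPureInjection (f.restrictScalars R) := by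
  refine isPureInjection_of_exists_lift (g := (LinearMap.range f).mkQ.restrictScalars R)
    hf.injective (LinearMap.exact_map_mkQ_range f) fun E _ _ _ h => ?_
  obtain ⟨k, hk⟩ := hf.exists_lift_of_finitePresentation (LinearMap.exact_map_mkQ_range f)
    (Submodule.mkQ_surjective _) (h.liftBaseChange S)
  exact ⟨k.restrictScalars R ∘ₗ TensorProduct.mk R S E 1, LinearMap.ext fun x => by
    simpa using LinearMap.congr_fun hk (1 ⊗ₜ x)⟩

end Converse

theorem FPModuleOver.exists_small_family (R : Type u) [CommRing R] (M : Type w) [AddCommGroup M]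
    [Module R M] : ∃ (I : Type (max u w)) (F : I → FPModuleOver R M),
      ∀ X : FPModuleOver R M, ∃ (i : I) (e : X →ₗ[R] F i), (F i).hom ∘ₗ e = X.hom := by
  have (n : ℕ) (K : {K : Submodule R (Fin n → R) // K.FG}) :
      Module.FinitePresentation R ((Fin n → R) ⧸ K.1) := finitePresentation_quotient_of_fg K.2
  refine ⟨Σ (n : ℕ) (K : {K : Submodule R (Fin n → R) // K.FG}), ((Fin n → R) ⧸ K.1) →ₗ[R] M,
    fun i => ⟨_, i.2.2⟩, fun X => ?_⟩
  obtain ⟨n, K, e, hK⟩ := Module.FinitePresentation.exists_fin R X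
  exact ⟨⟨n, ⟨K, hK⟩, X.hom ∘ₗ e.symm⟩, e, LinearMap.ext fun x => by simp⟩

variable {M : Type w} [AddCommGroup M] [Module R M]

namespace IsPureProjective

theorem exists_retract (hM : IsPureProjective R M) :
    ∃ (I : Type (max u w)) (F : I → FPModuleOver R M) (s : M →ₗ[R] Π₀ i, F i)
      (p : (Π₀ i, F i) →ₗ[R] M), p ∘ₗ s = LinearMap.id := by
  classical
  obtain ⟨I, F, hF⟩ := FPModuleOver.exists_small_family R M
  let p : (Π₀ i, F i) →ₗ[R] M := DFinsupp.lsum ℕ fun i => (F i).hom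
  have hp_lift (X : FPModuleOver R M) : ∃ k : X →ₗ[R] Π₀ i, F i, p ∘ₗ k = X.hom := by
    obtain ⟨i, e, he⟩ := hF X
    exact ⟨DFinsupp.lsingle i ∘ₗ e, by ext x; simp [p, ← he]⟩
  have hp : Function.Surjective p := fun x => by
    obtain ⟨k, hk⟩ := hp_lift ⟨R, LinearMap.toSpanSingleton R M x⟩
    exact ⟨k 1, by simpa using LinearMap.congr_fun hk (1 : R)⟩
  -- `IsPureProjective` tests modules in a single universe, hence the lift of `M`.
  let p' : (Π₀ i, F i) →ₗ[R] ULift.{u} M := ULift.moduleEquiv.symm.toLinearMap ∘ₗ p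
  have hp' : Function.Exact (LinearMap.ker p').subtype p' := p'.exact_subtype_ker_map
  have hpure : IsPureInjection (LinearMap.ker p').subtype :=
    isPureInjection_of_exists_lift (Submodule.injective_subtype _) hp' fun E _ _ _ h => by
      obtain ⟨k, hk⟩ := hp_lift ⟨E, ULift.moduleEquiv.toLinearMap ∘ₗ h⟩
      exact ⟨k, by rw [LinearMap.comp_assoc, hk]; ext; simp⟩
  obtain ⟨s, hs⟩ := hM _ _ _ _ p' ⟨hpure, hp', ULift.moduleEquiv.symm.surjective.comp hp⟩
    ULift.moduleEquiv.symm.toLinearMap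
  exact ⟨I, F, s, p, LinearMap.ext fun x => ULift.moduleEquiv.symm.injective
    (LinearMap.congr_fun hs x)⟩

theorem exists_lift (hM : IsPureProjective R M) {A B C : Type*} [AddCommGroup A] [Module R A]
    [AddCommGroup B] [Module R B] [AddCommGroup C] [Module R C] {f : A →ₗ[R] B} {g : B →ₗ[R] C}
    (hf : IsPureInjection f) (hfg : Function.Exact f g) (hg : Function.Surjective g)
    (h : M →ₗ[R] C) : ∃ k : M →ₗ[R] B, g ∘ₗ k = h := by
  classical
  obtain ⟨I, F, s, p, hps⟩ := hM.exists_retract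
  choose k hk using fun i =>
    hf.exists_lift_of_finitePresentation hfg hg (h ∘ₗ p ∘ₗ DFinsupp.lsingle i)
  have hgk : g ∘ₗ DFinsupp.lsum ℕ k = h ∘ₗ p := DFinsupp.lhom_ext fun i x => by
    simpa using LinearMap.congr_fun (hk i) x
  exact ⟨DFinsupp.lsum ℕ k ∘ₗ s, by
    rw [← LinearMap.comp_assoc, hgk, LinearMap.comp_assoc, hps, LinearMap.comp_id]⟩

theorem baseChange (hM : IsPureProjective R M) (S : Type v) [CommRing S] [Algebra R S] :
    IsPureProjective S (S ⊗[R] M) := by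
  intro A B C _ _ _ _ _ _ f g hfg h
  let _ : Module R A := Module.compHom A (algebraMap R S)
  let _ : Module R B := Module.compHom B (algebraMap R S)
  let _ : Module R C := Module.compHom C (algebraMap R S)
  have : IsScalarTower R S A := .of_algebraMap_smul fun _ _ => rfl
  have : IsScalarTower R S B := .of_algebraMap_smul fun _ _ => rfl
  have : IsScalarTower R S C := .of_algebraMap_smul fun _ _ => rfl
  obtain ⟨k, hk⟩ := hM.exists_lift (hfg.pure.restrictScalars (R := R))
    (g := g.restrictScalars R) hfg.exact hfg.surjective
    (h.restrictScalars R ∘ₗ TensorProduct.mk R S M 1)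
  refine ⟨k.liftBaseChange S, TensorProduct.AlgebraTensorModule.curry_injective
    (LinearMap.ext_ring (LinearMap.ext fun x => ?_))⟩
  simpa using LinearMap.congr_fun hk x

end IsPureProjective

end PureProjective

section PureExtension

variable {R : Type u} [CommRing R] {S : Type v} [CommRing S] [Algebra R S]

theorem isPureExtension_iff_mk_injective :
    IsPureExtension R S ↔ ∀ (X : Type u) [AddCommGroup X] [Module R X],
      Function.Injective (TensorProduct.mk R S X 1) := by
  have h_mk (X : Type u) [AddCommGroup X] [Module R X] : (Algebra.linearMap R S).rTensor X =
      TensorProduct.mk R S X 1 ∘ₗ (TensorProduct.lid R X).toLinearMap := by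
    ext; simp
  have h_inj (X : Type u) [AddCommGroup X] [Module R X] :
      Function.Injective ((Algebra.linearMap R S).rTensor X) ↔
        Function.Injective (TensorProduct.mk R S X 1) := by
    rw [h_mk]
    exact (TensorProduct.lid R X).toEquiv.injective_comp (TensorProduct.mk R S X 1)
  refine ⟨fun hS X _ _ => (h_inj X).1 (hS.rTensor_injective X), fun h => ⟨?_, fun X _ _ => ?_⟩⟩
  · have h_rid : Algebra.linearMap R S =
        (TensorProduct.rid R S).toLinearMap ∘ₗ TensorProduct.mk R S R 1 := by
      ext; simp
    rw [h_rid]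
    exact (TensorProduct.rid R S).injective.comp (h R)
  · exact (h_inj X).2 (h X)

theorem isPureExtension_of_faithfullyFlat [Module.FaithfullyFlat R S] : IsPureExtension R S :=
  isPureExtension_iff_mk_injective.2 fun X _ _ =>
    Module.FaithfullyFlat.tensorProduct_mk_injective X

theorem isPureExtension_adicCompletion (R : Type u) [CommRing R] [IsLocalRing R]
    [IsNoetherianRing R] :
    IsPureExtension R (AdicCompletion (IsLocalRing.maximalIdeal R) R) := by
  have hfg : (IsLocalRing.maximalIdeal R).FG := IsNoetherian.noetherian _
  have := AdicCompletion.isLocalRing_of_fg hfg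
  have := AdicCompletion.algebraMap_isLocalHom_of_fg hfg
  have : Module.Flat R (AdicCompletion (IsLocalRing.maximalIdeal R) R) :=
    AdicCompletion.flat_of_isNoetherian _
  have := Module.FaithfullyFlat.of_flat_of_isLocalHom (A := R)
    (B := AdicCompletion (IsLocalRing.maximalIdeal R) R)
  exact isPureExtension_of_faithfullyFlat

theorem IsPureExtension.isPureInjection_mk (hS : IsPureExtension R S) (E : Type u) [AddCommGroup E]
    [Module R E] : IsPureInjection (TensorProduct.mk R S E 1) := by
  rw [isPureExtension_iff_mk_injective] at hS
  refine ⟨hS E, fun W _ _ => ?_⟩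
  have h_mk : (TensorProduct.mk R S E 1).rTensor W =
      (TensorProduct.assoc R S E W).symm.toLinearMap ∘ₗ TensorProduct.mk R S (E ⊗[R] W) 1 := by
    ext; simp
  rw [h_mk]
  exact (TensorProduct.assoc R S E W).symm.injective.comp (hS (E ⊗[R] W))

theorem IsPureExtension.dominates_of_baseChange (hS : IsPureExtension R S) {E N : Type*}
    {E' : Type u} [AddCommGroup E] [Module R E] [AddCommGroup N] [Module R N]
    [AddCommGroup E'] [Module R E']
    {φ : E →ₗ[R] N} {g : E →ₗ[R] E'} {δ : S ⊗[R] N →ₗ[S] S ⊗[R] E'}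
    (hδ : δ ∘ₗ φ.baseChange S = g.baseChange S) : Dominates g φ := by
  refine (hS.isPureInjection_mk E').dominates_of_comp ?_
  have h_mk : TensorProduct.mk R S E' 1 ∘ₗ g =
      (δ.restrictScalars R ∘ₗ TensorProduct.mk R S N 1) ∘ₗ φ :=
    LinearMap.ext fun x => by simpa using (LinearMap.congr_fun hδ (1 ⊗ₜ x)).symm
  rw [h_mk]
  exact dominates_comp φ _

end PureExtension

section DirectedUnion

variable {R : Type u} [CommRing R] {ι : Type*} [Nonempty ι] {Y : ι → Type*}
  [∀ i, AddCommGroup (Y i)] [∀ i, Module R (Y i)] {A B N W : Type*} [AddCommGroup A] [Module R A]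
  [AddCommGroup B] [Module R B] [AddCommGroup N] [Module R N] [AddCommGroup W] [Module R W]

theorem exists_rTensor_eq_of_directed {k : ∀ i, Y i →ₗ[R] N}
    (hdir : Directed (· ≤ ·) fun i => LinearMap.range (k i)) (hk : ∀ x, ∃ i y, k i y = x)
    (z : N ⊗[R] W) : ∃ i t, (k i).rTensor W t = z := by
  have hdirW : Directed (· ≤ ·) fun i => LinearMap.range ((k i).rTensor W) := fun a b =>
    (hdir a b).imp fun _ h => ⟨range_rTensor_mono h.1, range_rTensor_mono h.2⟩
  refine (Submodule.mem_iSup_of_directed _ hdirW).1 ?_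
  induction z with
  | zero => exact zero_mem _
  | tmul x w =>
    obtain ⟨i, y, rfl⟩ := hk x
    exact Submodule.mem_iSup_of_mem i ⟨y ⊗ₜ w, LinearMap.rTensor_tmul _ _ _ _⟩
  | add x y hx hy => exact add_mem hx hy

theorem isPureInjection_of_directed {f : A →ₗ[R] B} {k : ∀ i, Y i →ₗ[R] A}
    (hdir : Directed (· ≤ ·) fun i => LinearMap.range (k i)) (hk : ∀ x, ∃ i y, k i y = x)
    (h : ∀ i, Dominates (k i) (f ∘ₗ k i)) : IsPureInjection f := by
  refine isPureInjection_iff_dominates.2 fun W _ _ z hz => ?_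
  obtain ⟨i, t, rfl⟩ := exists_rTensor_eq_of_directed hdir hk z
  rw [LinearMap.mem_ker, ← LinearMap.comp_apply, ← LinearMap.rTensor_comp] at hz
  simpa using h i W hz

theorem isPureInjection_subtype_bot : IsPureInjection (⊥ : Submodule R N).subtype :=
  isPureInjection_iff_dominates.2 fun W _ _ => by simp

theorem isPureInjection_subtype_sSup {c : Set (Submodule R N)} (hc : c.Nonempty)
    (hdir : DirectedOn (· ≤ ·) c) (h : ∀ K ∈ c, IsPureInjection K.subtype) :
    IsPureInjection (sSup c).subtype := by
  have : Nonempty c := hc.to_subtype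
  refine isPureInjection_of_directed (k := fun K : c => Submodule.inclusion (le_sSup K.2))
    (fun K L => ?_) (fun x => ?_) fun K => ?_
  · simp only [Submodule.range_inclusion]
    exact (hdir.directed_val K L).imp fun _ h =>
      ⟨Submodule.comap_mono h.1, Submodule.comap_mono h.2⟩
  · obtain ⟨K, hK, hx⟩ := (Submodule.mem_sSup_of_directed hc hdir).1 x.2
    exact ⟨⟨K, hK⟩, ⟨x, hx⟩, rfl⟩
  · rw [Submodule.subtype_comp_inclusion]
    exact (dominates_comp LinearMap.id (Submodule.inclusion (le_sSup K.2))).trans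
      (isPureInjection_iff_dominates.1 (h K K.2))

theorem exists_comp_eq_of_directed {k : ∀ i, Y i →ₗ[R] N} {l : ∀ i, Y i →ₗ[R] B}
    (hdir : Directed (· ≤ ·) fun i => LinearMap.range ((k i).prod (l i)))
    (hk : ∀ x, ∃ i y, k i y = x) (hker : ∀ i, LinearMap.ker (k i) ≤ LinearMap.ker (l i)) :
    ∃ h : N →ₗ[R] B, ∀ i, h ∘ₗ k i = l i := by
  set G := ⨆ i, LinearMap.range ((k i).prod (l i))
  have hmem {z : N × B} : z ∈ G ↔ ∃ i y, (k i y, l i y) = z := Submodule.mem_iSup_of_directed _ hdir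
  suffices hG : Function.Bijective (Prod.fst ∘ G.subtype) by
    obtain ⟨h, hh⟩ := Submodule.exists_eq_graph hG
    exact ⟨h, fun i => LinearMap.ext fun y =>
      ((LinearMap.mem_graph_iff h _).1 (hh ▸ hmem.2 ⟨i, y, rfl⟩)).symm⟩
  refine ⟨?_, fun x => ?_⟩
  · refine (injective_iff_map_eq_zero (LinearMap.fst R N B ∘ₗ G.subtype)).2 ?_
    rintro ⟨z, hz⟩ hz0
    obtain ⟨i, y, rfl⟩ := hmem.1 hz
    exact Subtype.ext (Prod.ext hz0 (hker i hz0))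
  · obtain ⟨i, y, rfl⟩ := hk x
    exact ⟨⟨_, hmem.2 ⟨i, y, rfl⟩⟩, rfl⟩

end DirectedUnion

section Tower

variable {R : Type u} [CommRing R] {M : Type w} [AddCommGroup M] [Module R M]

theorem directed_range_of_comp_eq {N : Type*} [AddCommGroup N] [Module R N] {Y : ℕ → Type*}
    [∀ n, AddCommGroup (Y n)] [∀ n, Module R (Y n)] {t : ∀ n, Y n →ₗ[R] Y (n + 1)}
    {k : ∀ n, Y n →ₗ[R] N} (h : ∀ n, k (n + 1) ∘ₗ t n = k n) :
    Directed (· ≤ ·) fun n => LinearMap.range (k n) :=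
  (monotone_nat_of_le_succ fun n => h n ▸ LinearMap.range_comp_le_range _ _).directed_le

/-- A sequence of finitely presented modules over `M` in which the map out of each stage dominates
its map to `M`: a Mittag-Leffler system whose colimit is a countably generated pure submodule. -/
structure FPTower (R : Type u) [CommRing R] (M : Type w) [AddCommGroup M] [Module R M] where
  X : ℕ → FPModuleOver R M
  t : ∀ n, X n →ₗ[R] X (n + 1)
  hom_comp : ∀ n, (X (n + 1)).hom ∘ₗ t n = (X n).hom
  dominates : ∀ n, Dominates (t n) (X n).hom

namespace FPTower

variable (𝒯 : FPTower R M)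

/-- The submodule of `M` covered by the stages of a tower. -/
def union : Submodule R M := ⨆ n, LinearMap.range (𝒯.X n).hom

/-- The structure map of a stage, with codomain the union of the tower. -/
def toUnion (n : ℕ) : 𝒯.X n →ₗ[R] 𝒯.union :=
  (𝒯.X n).hom.codRestrict 𝒯.union fun x =>
    Submodule.mem_iSup_of_mem n (LinearMap.mem_range_self _ x)

theorem subtype_comp_toUnion (n : ℕ) : 𝒯.union.subtype ∘ₗ 𝒯.toUnion n = (𝒯.X n).hom :=
  rfl

theorem toUnion_comp (n : ℕ) : 𝒯.toUnion (n + 1) ∘ₗ 𝒯.t n = 𝒯.toUnion n :=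
  LinearMap.ext fun x => Subtype.ext (LinearMap.congr_fun (𝒯.hom_comp n) x)

theorem exists_toUnion_eq (x : 𝒯.union) : ∃ n y, 𝒯.toUnion n y = x := by
  obtain ⟨n, y, h⟩ :=
    (Submodule.mem_iSup_of_directed _ (directed_range_of_comp_eq 𝒯.hom_comp)).1 x.2
  exact ⟨n, y, Subtype.ext h⟩

theorem isPureInjection_subtype_union : IsPureInjection 𝒯.union.subtype := by
  refine isPureInjection_of_directed (directed_range_of_comp_eq 𝒯.toUnion_comp)
    𝒯.exists_toUnion_eq fun n => ?_
  rw [subtype_comp_toUnion, ← toUnion_comp]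
  exact (dominates_comp _ _).trans (𝒯.dominates n)

theorem exists_comp_comp_eq (n : ℕ) :
    ∃ r : 𝒯.X (n + 2) →ₗ[R] 𝒯.X (n + 1), r ∘ₗ 𝒯.t (n + 1) ∘ₗ 𝒯.t n = 𝒯.t n := by
  refine ((𝒯.dominates n).trans ?_).exists_comp_eq
  rw [← 𝒯.hom_comp n, ← 𝒯.hom_comp (n + 1), LinearMap.comp_assoc]
  exact dominates_comp _ _

theorem exists_comp_eq_of_comp_eq {B : Type*} [AddCommGroup B] [Module R B]
    (k : ∀ n, 𝒯.X n →ₗ[R] B) (hk : ∀ n, k (n + 1) ∘ₗ 𝒯.t n = k n) :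
    ∃ l : 𝒯.union →ₗ[R] B, ∀ n, l ∘ₗ 𝒯.toUnion n = k n := by
  refine exists_comp_eq_of_directed (directed_range_of_comp_eq (t := 𝒯.t) fun n => ?_)
    𝒯.exists_toUnion_eq fun n => ?_
  · rw [LinearMap.prod_comp, toUnion_comp, hk]
  · rw [← hk, ← LinearMap.ker_comp_of_ker_eq_bot (𝒯.toUnion n) 𝒯.union.ker_subtype]
    exact (𝒯.dominates n).ker_le.trans (LinearMap.ker_le_ker_comp _ _)

theorem exists_lift_succ {B C : Type*} [AddCommGroup B] [Module R B] [AddCommGroup C] [Module R C]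
    {g : B →ₗ[R] C} {h : 𝒯.union →ₗ[R] C}
    (hlift : ∀ n, ∃ k : 𝒯.X n →ₗ[R] B, g ∘ₗ k = h ∘ₗ 𝒯.toUnion n)
    {n : ℕ} {k : 𝒯.X (n + 1) →ₗ[R] B} (hk : g ∘ₗ k = h ∘ₗ 𝒯.toUnion (n + 1)) :
    ∃ k' : 𝒯.X (n + 2) →ₗ[R] B,
      g ∘ₗ k' = h ∘ₗ 𝒯.toUnion (n + 2) ∧ (k' ∘ₗ 𝒯.t (n + 1)) ∘ₗ 𝒯.t n = k ∘ₗ 𝒯.t n := by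
  obtain ⟨k₀, hk₀⟩ := hlift (n + 2)
  obtain ⟨r, hr⟩ := 𝒯.exists_comp_comp_eq n
  have hdiff : g ∘ₗ (k₀ ∘ₗ 𝒯.t (n + 1) - k) = 0 := by
    rw [LinearMap.comp_sub, ← LinearMap.comp_assoc, hk₀, hk, LinearMap.comp_assoc,
      toUnion_comp, sub_self]
  refine ⟨k₀ - (k₀ ∘ₗ 𝒯.t (n + 1) - k) ∘ₗ r, ?_, ?_⟩
  · rw [LinearMap.comp_sub, ← LinearMap.comp_assoc, hdiff, LinearMap.zero_comp, sub_zero, hk₀]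
  · rw [LinearMap.comp_assoc, LinearMap.sub_comp, LinearMap.comp_assoc (𝒯.t (n + 1) ∘ₗ 𝒯.t n), hr,
      LinearMap.sub_comp, LinearMap.comp_assoc, sub_sub_cancel]

theorem isPureProjective_union : IsPureProjective R 𝒯.union := by
  intro A B C _ _ _ _ _ _ f g hfg h
  have hlift (n : ℕ) : ∃ k : 𝒯.X n →ₗ[R] B, g ∘ₗ k = h ∘ₗ 𝒯.toUnion n :=
    hfg.pure.exists_lift_of_finitePresentation hfg.exact hfg.surjective _
  let Lift (n : ℕ) := {k : 𝒯.X (n + 1) →ₗ[R] B // g ∘ₗ k = h ∘ₗ 𝒯.toUnion (n + 1)}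
  have hsucc (n : ℕ) (k : Lift n) :
      ∃ k' : Lift (n + 1), (k'.1 ∘ₗ 𝒯.t (n + 1)) ∘ₗ 𝒯.t n = k.1 ∘ₗ 𝒯.t n := by
    obtain ⟨k', hk', hcomp⟩ := 𝒯.exists_lift_succ hlift k.2
    exact ⟨⟨k', hk'⟩, hcomp⟩
  choose next hnext using hsucc
  obtain ⟨k₀, hk₀⟩ := hlift 1
  let k (n : ℕ) : Lift n := Nat.rec ⟨k₀, hk₀⟩ next n
  obtain ⟨l, hl⟩ := 𝒯.exists_comp_eq_of_comp_eq (fun n => (k n).1 ∘ₗ 𝒯.t n) fun n => hnext n (k n)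
  refine ⟨l, LinearMap.ext fun x => ?_⟩
  obtain ⟨n, y, rfl⟩ := 𝒯.exists_toUnion_eq x
  have : (g ∘ₗ l) ∘ₗ 𝒯.toUnion n = h ∘ₗ 𝒯.toUnion n := by
    rw [LinearMap.comp_assoc, hl, ← LinearMap.comp_assoc, (k n).2, LinearMap.comp_assoc,
      toUnion_comp]
  exact LinearMap.congr_fun this y

end FPTower

end Tower

section Devissage

variable {R : Type u} [CommRing R]

section ShortExact

variable {A B C E P Q : Type*} [AddCommGroup A] [Module R A] [AddCommGroup B] [Module R B]
  [AddCommGroup C] [Module R C] [AddCommGroup E] [Module R E] [AddCommGroup P] [Module R P]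
  [AddCommGroup Q] [Module R Q]

theorem IsPureInjection.of_comp {f : A →ₗ[R] B} {g : B →ₗ[R] C}
    (h : IsPureInjection (g ∘ₗ f)) : IsPureInjection f :=
  isPureInjection_iff_dominates.2 <|
    (isPureInjection_iff_dominates.1 h).trans (dominates_comp f g)

theorem IsPureInjection.of_exact {j : A →ₗ[R] E} {q : E →ₗ[R] Q} (hjq : Function.Exact j q)
    (hq : Function.Surjective q) {i : E →ₗ[R] B} {r : B →ₗ[R] P} {ι : Q →ₗ[R] P}
    (hcomm : ι ∘ₗ q = r ∘ₗ i) (hι : IsPureInjection ι) (hij : IsPureInjection (i ∘ₗ j)) :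
    IsPureInjection i := by
  have hq_dom : Dominates q i := hι.dominates_of_comp (hcomm ▸ dominates_comp i r)
  refine isPureInjection_iff_dominates.2 fun W _ _ z hz => ?_
  obtain ⟨y, rfl⟩ := (rTensor_exact W hjq hq z).1 (hq_dom W hz)
  rw [LinearMap.mem_ker, ← LinearMap.comp_apply, ← LinearMap.rTensor_comp] at hz
  rw [hij.rTensor_injective W (hz.trans (map_zero _).symm), map_zero]
  exact zero_mem _

theorem IsPureProjective.exists_lift_extension {j : A →ₗ[R] E} {q : E →ₗ[R] Q}
    (hQ : IsPureProjective R Q) (hj : IsPureInjection j) (hjq : Function.Exact j q)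
    (hq : Function.Surjective q) {f : P →ₗ[R] B} {g : B →ₗ[R] C} (hf : IsPureInjection f)
    (hfg : Function.Exact f g) (hg : Function.Surjective g) {h : E →ₗ[R] C} {k : A →ₗ[R] B}
    (hk : g ∘ₗ k = h ∘ₗ j) : ∃ k' : E →ₗ[R] B, g ∘ₗ k' = h ∧ k' ∘ₗ j = k := by
  obtain ⟨σ, hσ⟩ := hQ.exists_lift hj hjq hq LinearMap.id
  obtain ⟨-, ρ, hρ⟩ := (hjq.split_tfae'.out 0 1 rfl rfl).1 ⟨hj.injective, σ, hσ⟩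
  obtain ⟨e, he⟩ := (LinearMap.exact_lcomp_of_exact_of_surjective C hjq hq
      (h - g ∘ₗ k ∘ₗ ρ)).1 <| by
    change (h - g ∘ₗ k ∘ₗ ρ) ∘ₗ j = 0
    rw [LinearMap.sub_comp, LinearMap.comp_assoc, LinearMap.comp_assoc, hρ, LinearMap.comp_id, hk,
      sub_self]
  replace he : e ∘ₗ q = h - g ∘ₗ k ∘ₗ ρ := he
  obtain ⟨b, hb⟩ := hQ.exists_lift hf hfg hg e
  refine ⟨k ∘ₗ ρ + b ∘ₗ q, ?_, ?_⟩
  · rw [LinearMap.comp_add, ← LinearMap.comp_assoc _ b g, hb, he, add_sub_cancel]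
  · rw [LinearMap.add_comp, LinearMap.comp_assoc, hρ, LinearMap.comp_assoc,
      hjq.linearMap_comp_eq_zero, LinearMap.comp_zero, add_zero, LinearMap.comp_id]

end ShortExact

variable {M : Type w} [AddCommGroup M] [Module R M] {N : Submodule R M}

theorem exact_inclusion_submoduleComap_mkQ (N' : Submodule R (M ⧸ N)) :
    Function.Exact (Submodule.inclusion (Submodule.le_comap_mkQ N N'))
      (N.mkQ.submoduleComap N') := fun x =>
  ⟨fun h => ⟨⟨x, (Submodule.Quotient.mk_eq_zero N).1 congr(($h).1)⟩, rfl⟩, by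
    rintro ⟨y, rfl⟩
    exact Subtype.ext ((Submodule.Quotient.mk_eq_zero N).2 y.2)⟩

theorem IsPureInjection.subtype_comap_mkQ {N' : Submodule R (M ⧸ N)}
    (hN : IsPureInjection N.subtype) (hN' : IsPureInjection N'.subtype) :
    IsPureInjection (N'.comap N.mkQ).subtype :=
  .of_exact (r := N.mkQ) (exact_inclusion_submoduleComap_mkQ N')
    (N.mkQ.submoduleComap_surjective_of_surjective N' N.mkQ_surjective) rfl hN' hN

theorem comp_toFun_sSup {B C : Type*} [AddCommGroup B] [Module R B] [AddCommGroup C] [Module R C]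
    {g : B →ₗ[R] C} {h : M →ₗ[R] C} {c : Set (M →ₗ.[R] B)} (hc : c.Nonempty)
    (hdir : DirectedOn (· ≤ ·) c) (hcomp : ∀ k ∈ c, g ∘ₗ k.toFun = h ∘ₗ k.domain.subtype) :
    g ∘ₗ (LinearPMap.sSup c hdir).toFun = h ∘ₗ (LinearPMap.sSup c hdir).domain.subtype := by
  refine LinearMap.ext fun x => ?_
  obtain ⟨k, hk, hx⟩ := (LinearPMap.mem_domain_sSup_iff hc hdir).1 x.2
  exact (congr_arg g (LinearPMap.sSup_apply hdir hk ⟨x, hx⟩)).trans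
    (LinearMap.congr_fun (hcomp k hk) ⟨x, hx⟩)

theorem isPureProjective_of_devissage {p : Submodule R M → Prop}
    (pure : ∀ N, p N → IsPureInjection N.subtype) (bot : p ⊥)
    (sSup : ∀ c : Set (Submodule R M), c.Nonempty → DirectedOn (· ≤ ·) c → (∀ N ∈ c, p N) →
      p (sSup c))
    (step : ∀ N, p N → ∀ x : M, ∃ N' : Submodule R (M ⧸ N),
      N.mkQ x ∈ N' ∧ IsPureProjective R N' ∧ p (N'.comap N.mkQ)) :
    IsPureProjective R M := by
  intro A B C _ _ _ _ _ _ f g hfg h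
  let lifts : Set (M →ₗ.[R] B) := {k | p k.domain ∧ g ∘ₗ k.toFun = h ∘ₗ k.domain.subtype}
  obtain ⟨k, -, hk⟩ := zorn_le_nonempty₀ lifts (fun c hc hchain k₀ hk₀ => by
      have hdir := hchain.directedOn
      refine ⟨LinearPMap.sSup c hdir, ⟨?_, comp_toFun_sSup ⟨k₀, hk₀⟩ hdir fun k hk => (hc hk).2⟩,
        fun k => LinearPMap.le_sSup hdir⟩
      refine sSup _ ⟨_, k₀, hk₀, rfl⟩ (hdir.mono_comp fun _ _ hle => hle.1) ?_
      rintro _ ⟨k, hk, rfl⟩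
      exact (hc hk).1)
    ⊥ ⟨bot, LinearMap.ext fun x => by
      rw [show x = 0 from Subtype.ext ((Submodule.mem_bot R).1 x.2), map_zero, map_zero]⟩
  obtain ⟨hpk, hkh⟩ := hk.prop
  have mem_domain (x : M) : x ∈ k.domain := by
    obtain ⟨N', hxN', hN', hcomap⟩ := step k.domain hpk x
    have hincl := Submodule.le_comap_mkQ k.domain N'
    obtain ⟨k', hk'h, hk'k⟩ := hN'.exists_lift_extension
      (.of_comp (g := (N'.comap k.domain.mkQ).subtype) (pure _ hpk))
      (exact_inclusion_submoduleComap_mkQ N')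
      (k.domain.mkQ.submoduleComap_surjective_of_surjective N' k.domain.mkQ_surjective)
      hfg.pure hfg.exact hfg.surjective (h := h ∘ₗ (N'.comap k.domain.mkQ).subtype) hkh
    refine (hk.le_of_ge (y := ⟨_, k'⟩) ⟨hcomap, hk'h⟩ ⟨hincl, fun y z hyz => ?_⟩).1 hxN'
    obtain rfl : z = Submodule.inclusion hincl y := Subtype.ext hyz.symm
    exact (LinearMap.congr_fun hk'k y).symm
  exact ⟨k.toFun ∘ₗ LinearMap.id.codRestrict k.domain mem_domain,
    LinearMap.ext fun x => LinearMap.congr_fun hkh ⟨x, mem_domain x⟩⟩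

end Devissage

section Retract

variable {S I : Type*} [CommRing S] {F : I → Type*} [∀ i, AddCommGroup (F i)] [∀ i, Module S (F i)]

theorem exists_finset_forall_notMem_apply_eq_zero {P : Type*} [AddCommGroup P] [Module S P]
    [Module.Finite S P] (a : P →ₗ[S] Π₀ i, F i) : ∃ T : Finset I, ∀ x, ∀ i ∉ T, a x i = 0 := by
  classical
  obtain ⟨G, hG⟩ := Module.Finite.fg_top (R := S) (M := P)
  refine ⟨G.biUnion fun x => (a x).support, fun x i hi => ?_⟩
  have hai : DFinsupp.lapply i ∘ₗ a = 0 := LinearMap.ext_on hG fun y hy =>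
    DFinsupp.notMem_support_iff.1 fun h => hi (Finset.mem_biUnion.2 ⟨y, hy, h⟩)
  exact LinearMap.congr_fun hai x

variable [DecidableEq I]

theorem exists_comp_eq_filterLinearMap (T : Finset I) :
    ∃ (res : (Π₀ i, F i) →ₗ[S] ∀ i : T, F i) (inc : (∀ i : T, F i) →ₗ[S] Π₀ i, F i),
      inc ∘ₗ res = DFinsupp.filterLinearMap S F (· ∈ T) := by
  refine ⟨LinearMap.pi fun i => DFinsupp.lapply i.1,
    ∑ i : T, DFinsupp.lsingle i.1 ∘ₗ LinearMap.proj i, DFinsupp.lhom_ext fun i v => ?_⟩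
  simp only [LinearMap.comp_apply, LinearMap.sum_apply, LinearMap.proj_apply, LinearMap.pi_apply,
    DFinsupp.lapply_apply, DFinsupp.lsingle_apply, DFinsupp.filterLinearMap_apply,
    DFinsupp.filter_single]
  rw [Finset.sum_coe_sort T fun j => DFinsupp.single j (DFinsupp.single i v j)]
  split_ifs with hi
  · rw [Finset.sum_eq_single_of_mem i hi fun j _ hj => by
      rw [DFinsupp.single_eq_of_ne hj, DFinsupp.single_zero], DFinsupp.single_eq_same]
  · refine Finset.sum_eq_zero fun j hj => ?_
    rw [DFinsupp.single_eq_of_ne (ne_of_mem_of_not_mem hj hi), DFinsupp.single_zero]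

variable {R : Type u} [CommRing R] {M : Type w} [AddCommGroup M] [Module R M] [Algebra R S]

theorem FPModuleOver.exists_extension_of_retract [∀ i, Module.FinitePresentation S (F i)]
    {s : S ⊗[R] M →ₗ[S] Π₀ i, F i} {p : (Π₀ i, F i) →ₗ[S] S ⊗[R] M} (hps : p ∘ₗ s = LinearMap.id)
    (X : FPModuleOver R M) :
    ∃ (Y : FPModuleOver R M) (g : X →ₗ[R] Y) (δ : S ⊗[R] M →ₗ[S] S ⊗[R] Y) (T : Finset I),
      Y.hom ∘ₗ g = X.hom ∧ δ ∘ₗ X.hom.baseChange S = g.baseChange S ∧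
      (∀ x, ∀ i ∉ T, s (X.hom.baseChange S x) i = 0) ∧
      ∀ i ∈ T, ∀ v, p (DFinsupp.single i v) ∈ LinearMap.range (Y.hom.baseChange S) := by
  obtain ⟨T, hT⟩ := exists_finset_forall_notMem_apply_eq_zero (s ∘ₗ X.hom.baseChange S)
  obtain ⟨res, inc, h_inc⟩ := exists_comp_eq_filterLinearMap (S := S) (F := F) T
  have h_filter (x : S ⊗[R] X) :
      inc (res (s (X.hom.baseChange S x))) = s (X.hom.baseChange S x) := by
    rw [← LinearMap.comp_apply inc, h_inc]
    refine DFinsupp.ext fun i => ?_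
    rw [DFinsupp.filterLinearMap_apply, DFinsupp.filter_apply, ite_eq_left_iff]
    exact fun hi => (hT x i hi).symm
  obtain ⟨Y, g, c, hg, hcg, hcY⟩ := X.exists_factor_baseChange
    (a := res ∘ₗ s ∘ₗ X.hom.baseChange S) (b := p ∘ₗ inc) <| LinearMap.ext fun x => by
      simp only [LinearMap.comp_apply, h_filter]
      exact LinearMap.congr_fun hps _
  refine ⟨Y, g, c ∘ₗ res ∘ₗ s, T, hg, hcg, hT, fun i hi v => ⟨c (res (DFinsupp.single i v)), ?_⟩⟩
  rw [← LinearMap.comp_apply, hcY, LinearMap.comp_apply, ← LinearMap.comp_apply inc, h_inc,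
    DFinsupp.filterLinearMap_apply, DFinsupp.filter_single_pos _ _ hi]

end Retract

section Adapted

variable {R : Type u} [CommRing R] {M : Type w} [AddCommGroup M] [Module R M] {S : Type v}
  [CommRing S] [Algebra R S]

theorem comap_baseChange_le_baseChange_comap {M' : Type*} [AddCommGroup M'] [Module R M']
    {q : M →ₗ[R] M'} (hq : Function.Surjective q) (N' : Submodule R M') :
    (N'.baseChange S).comap (q.baseChange S) ≤ (N'.comap q).baseChange S := by
  rintro z ⟨t, ht⟩
  obtain ⟨t, rfl⟩ := LinearMap.baseChange_surjective S
    (q.submoduleComap_surjective_of_surjective N' hq) t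
  have hzt : q.baseChange S z = q.baseChange S ((N'.comap q).subtype.baseChange S t) := by
    rw [← ht, ← LinearMap.comp_apply, ← LinearMap.comp_apply, ← LinearMap.baseChange_comp,
      ← LinearMap.baseChange_comp]
    rfl
  have hker : z - (N'.comap q).subtype.baseChange S t ∈ (LinearMap.ker q).baseChange S :=
    (lTensor_exact S q.exact_subtype_ker_map hq _).1 ((map_sub _ _ _).trans (sub_eq_zero.2 hzt))
  rw [← sub_add_cancel z ((N'.comap q).subtype.baseChange S t)]
  exact add_mem (Submodule.baseChange_mono S (LinearMap.ker_le_comap q) hker) ⟨t, rfl⟩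

variable {I : Type*} [DecidableEq I] {F : I → Type*} [∀ i, AddCommGroup (F i)]
  [∀ i, Module S (F i)]

/-- Let `s` and `p` exhibit `S ⊗ M` as a retract of the direct sum of the `F i`. A pure submodule
`N` of `M` is *adapted* to a set `J` of indices if `s` maps `S ⊗ N` into the partial sum over `J`
and `p` maps that partial sum into `S ⊗ N`, so that `S ⊗ N` and `S ⊗ (M ⧸ N)` are retracts of the
partial sums over `J` and its complement. -/
structure IsAdapted (s : S ⊗[R] M →ₗ[S] Π₀ i, F i) (p : (Π₀ i, F i) →ₗ[S] S ⊗[R] M)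
    (N : Submodule R M) (J : Set I) : Prop where
  pure : IsPureInjection N.subtype
  apply_eq_zero : ∀ y ∈ N, ∀ i ∉ J, s (1 ⊗ₜ y) i = 0
  single_mem : ∀ i ∈ J, ∀ v, p (DFinsupp.single i v) ∈ N.baseChange S

variable {s : S ⊗[R] M →ₗ[S] Π₀ i, F i} {p : (Π₀ i, F i) →ₗ[S] S ⊗[R] M}

theorem isAdapted_bot : IsAdapted s p ⊥ ∅ :=
  ⟨isPureInjection_subtype_bot, fun y hy i _ => by simp [(Submodule.mem_bot R).1 hy], by simp⟩

theorem exists_isAdapted_sSup {c : Set (Submodule R M)} (hc : c.Nonempty)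
    (hdir : DirectedOn (· ≤ ·) c) (h : ∀ N ∈ c, ∃ J, IsAdapted s p N J) :
    ∃ J, IsAdapted s p (sSup c) J := by
  choose! J hJ using h
  refine ⟨⋃ N ∈ c, J N, isPureInjection_subtype_sSup hc hdir fun N hN => (hJ N hN).pure,
    fun y hy i hi => ?_, fun i hi v => ?_⟩
  · obtain ⟨N, hN, hyN⟩ := (Submodule.mem_sSup_of_directed hc hdir).1 hy
    exact (hJ N hN).apply_eq_zero y hyN i fun hiN => hi (Set.mem_biUnion hN hiN)
  · obtain ⟨N, hN, hiN⟩ := Set.mem_iUnion₂.1 hi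
    exact Submodule.baseChange_mono S (le_sSup hN) ((hJ N hN).single_mem i hiN v)

namespace IsAdapted

variable {N : Submodule R M} {J : Set I}

theorem apply_eq_zero_of_mem_baseChange (h : IsAdapted s p N J) {z : S ⊗[R] M}
    (hz : z ∈ N.baseChange S) {i : I} (hi : i ∉ J) : s z i = 0 := by
  have hle : N.baseChange S ≤ LinearMap.ker (DFinsupp.lapply i ∘ₗ s) := by
    rw [Submodule.baseChange_eq_span, Submodule.span_le]
    rintro _ ⟨y, hy, rfl⟩
    exact h.apply_eq_zero y hy i hi
  exact hle hz

variable [DecidablePred (· ∈ J)]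

theorem filter_mem_baseChange (h : IsAdapted s p N J) (x : Π₀ i, F i) :
    p (x.filter (· ∈ J)) ∈ N.baseChange S := by
  induction x using DFinsupp.induction with
  | h0 => simp
  | ha i v x _ _ hx =>
    rw [DFinsupp.filter_add, map_add]
    refine add_mem ?_ hx
    rw [DFinsupp.filter_single]
    split_ifs with hi
    · exact h.single_mem i hi v
    · simp

theorem exists_retract_quotient (h : IsAdapted s p N J) (hps : p ∘ₗ s = LinearMap.id) :
    ∃ s' : S ⊗[R] (M ⧸ N) →ₗ[S] Π₀ i, F i, (N.mkQ.baseChange S ∘ₗ p) ∘ₗ s' = LinearMap.id ∧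
      s' ∘ₗ N.mkQ.baseChange S = DFinsupp.filterLinearMap S F (· ∉ J) ∘ₗ s := by
  have hq : Function.Surjective (N.mkQ.baseChange S) :=
    LinearMap.baseChange_surjective S N.mkQ_surjective
  have hex : Function.Exact (N.subtype.baseChange S) (N.mkQ.baseChange S) :=
    lTensor_exact S (LinearMap.exact_subtype_mkQ N) N.mkQ_surjective
  obtain ⟨s', hs'⟩ := (LinearMap.exact_lcomp_of_exact_of_surjective (Π₀ i, F i) hex hq
      (DFinsupp.filterLinearMap S F (· ∉ J) ∘ₗ s)).1 <|
      LinearMap.ext fun t => DFinsupp.ext fun i => by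
    change (s (N.subtype.baseChange S t)).filter (· ∉ J) i = 0
    rw [DFinsupp.filter_apply, ite_eq_right_iff]
    exact h.apply_eq_zero_of_mem_baseChange ⟨t, rfl⟩
  replace hs' : s' ∘ₗ N.mkQ.baseChange S = DFinsupp.filterLinearMap S F (· ∉ J) ∘ₗ s := hs'
  refine ⟨s', ?_, hs'⟩
  rw [← LinearMap.cancel_right hq, LinearMap.comp_assoc, hs', LinearMap.id_comp]
  refine LinearMap.ext fun z => ?_
  have h_filter : N.mkQ.baseChange S (p ((s z).filter (· ∈ J))) = 0 :=
    (hex _).2 (h.filter_mem_baseChange (s z))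
  calc N.mkQ.baseChange S (p ((s z).filter (· ∉ J)))
      = N.mkQ.baseChange S (p ((s z).filter (· ∈ J) + (s z).filter (· ∉ J))) := by
        rw [map_add, map_add, h_filter, zero_add]
    _ = N.mkQ.baseChange S z := by
        rw [DFinsupp.filter_add_filter_not, ← LinearMap.comp_apply p, hps, LinearMap.id_apply]

theorem comap_mkQ (h : IsAdapted s p N J) {s' : S ⊗[R] (M ⧸ N) →ₗ[S] Π₀ i, F i}
    (hs' : s' ∘ₗ N.mkQ.baseChange S = DFinsupp.filterLinearMap S F (· ∉ J) ∘ₗ s)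
    {N' : Submodule R (M ⧸ N)} {J' : Set I}
    (h' : IsAdapted s' (N.mkQ.baseChange S ∘ₗ p) N' J') :
    IsAdapted s p (N'.comap N.mkQ) (J ∪ J') := by
  refine ⟨h.pure.subtype_comap_mkQ h'.pure, fun y hy i hi => ?_, ?_⟩
  · rw [Set.mem_union, not_or] at hi
    have hi' : ((s (1 ⊗ₜ y)).filter (· ∉ J)) i = 0 := by
      rw [← h'.apply_eq_zero _ hy i hi.2]
      exact congr($hs' (1 ⊗ₜ y) i).symm
    rwa [DFinsupp.filter_apply, if_pos hi.1] at hi'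
  · rintro i (hi | hi) v
    · exact Submodule.baseChange_mono S (Submodule.le_comap_mkQ N N') (h.single_mem i hi v)
    · exact comap_baseChange_le_baseChange_comap N.mkQ_surjective N' (h'.single_mem i hi v)

end IsAdapted

theorem FPTower.isAdapted_union (𝒯 : FPTower R M) {T : ℕ → Finset I}
    (hs : ∀ n x, ∀ i ∉ T n, s ((𝒯.X n).hom.baseChange S x) i = 0)
    (hp : ∀ n, ∀ i ∈ T n, ∀ v,
      p (DFinsupp.single i v) ∈ LinearMap.range ((𝒯.X (n + 1)).hom.baseChange S)) :
    IsAdapted s p 𝒯.union (⋃ n, T n) := by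
  refine ⟨𝒯.isPureInjection_subtype_union, fun y hy i hi => ?_, fun i hi v => ?_⟩
  · obtain ⟨n, y', hy'⟩ := 𝒯.exists_toUnion_eq ⟨y, hy⟩
    obtain rfl : (𝒯.X n).hom y' = y := congr_arg Subtype.val hy'
    exact hs n (1 ⊗ₜ y') i fun h => hi (Set.mem_iUnion.2 ⟨n, h⟩)
  · obtain ⟨n, hn⟩ := Set.mem_iUnion.1 hi
    have hmem := hp n i hn v
    rw [← 𝒯.subtype_comp_toUnion, LinearMap.baseChange_comp] at hmem
    exact LinearMap.range_comp_le_range _ _ hmem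

variable [∀ i, Module.FinitePresentation S (F i)]

theorem IsPureExtension.exists_isAdapted_isPureProjective (hS : IsPureExtension R S)
    (hps : p ∘ₗ s = LinearMap.id) (x : M) :
    ∃ (N : Submodule R M) (J : Set I), x ∈ N ∧ IsPureProjective R N ∧ IsAdapted s p N J := by
  choose next g δ T hg hδ hsT hpT using FPModuleOver.exists_extension_of_retract hps
  let X (n : ℕ) : FPModuleOver R M :=
    Nat.rec ⟨R, LinearMap.toSpanSingleton R M x⟩ (fun _ => next) n
  have hdom (Y : FPModuleOver R M) : Dominates (g Y) Y.hom := hS.dominates_of_baseChange (hδ Y)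
  let 𝒯 : FPTower R M := ⟨X, fun n => g (X n), fun n => hg (X n), fun n => hdom (X n)⟩
  refine ⟨𝒯.union, ⋃ n, T (X n), ?_, 𝒯.isPureProjective_union,
    𝒯.isAdapted_union (fun n => hsT (X n)) fun n => hpT (X n)⟩
  exact Submodule.mem_iSup_of_mem 0 ⟨(1 : R), LinearMap.toSpanSingleton_apply_one R M x⟩

end Adapted

theorem IsPureProjective.of_baseChange {R : Type u} [CommRing R] {M : Type w} [AddCommGroup M]
    [Module R M] {S : Type v} [CommRing S] [Algebra R S] (hS : IsPureExtension R S)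
    (hM : IsPureProjective S (S ⊗[R] M)) : IsPureProjective R M := by
  classical
  obtain ⟨I, F, s, p, hps⟩ := hM.exists_retract
  refine isPureProjective_of_devissage (p := fun N => ∃ J, IsAdapted s p N J)
    (fun N ⟨_, hN⟩ => hN.pure) ⟨∅, isAdapted_bot⟩ (fun c => exists_isAdapted_sSup)
    fun N ⟨J, hN⟩ x => ?_
  obtain ⟨s', hps', hs'⟩ := hN.exists_retract_quotient hps
  obtain ⟨N', J', hx, hpp, hN'⟩ := hS.exists_isAdapted_isPureProjective hps' (N.mkQ x)
  exact ⟨N', hx, hpp, J ∪ J', hN.comap_mkQ hs' hN'⟩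

theorem mainTheorem3 :
    (∀ (R : Type u) (S : Type v) [CommRing R] [CommRing S] [Algebra R S],
      IsPureExtension R S →
      ∀ (M : Type w) [AddCommGroup M] [Module R M],
        IsPureProjective R M ↔ IsPureProjective S (S ⊗[R] M)) ∧
    (∀ (R : Type u) [CommRing R] [IsLocalRing R] [IsNoetherianRing R]
      (P : Type w) [AddCommGroup P] [Module R P],
        IsPureProjective R P ↔
          IsPureProjective (AdicCompletion (IsLocalRing.maximalIdeal R) R)
            (AdicCompletion (IsLocalRing.maximalIdeal R) R ⊗[R] P)) :=
  ⟨fun _ S _ _ _ hS _ _ _ => ⟨fun h => h.baseChange S, .of_baseChange hS⟩,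
    fun R _ _ _ _ _ _ => ⟨fun h => h.baseChange _,
      .of_baseChange (isPureExtension_adicCompletion R)⟩⟩
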